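/- Fix a bijection $\nu:\mathbb{N}\to\mathbb{Q}$ with $\nu(0)=0$. A sequence $w\in\mathbb{N}^{\mathbb{N}}$ is a ($\rho$-)name of $x\in\mathbb{R}$, written $\rho(w)=x$, if $|\nu(w(i))-x|\le 2^{-i}$ for all $i\in\mathbb{N}$. A multi-valued function is identified with the set of its choice functions, each defined exactly on the domain of the multi-valued function. For multi-valued functions $P,Q$ write $P\le_2 Q$ if there are continuous partial functions $F,G$ (continuous on their domains, with the subspace topology; $\mathbb{N}^{\mathbb{N}}$ carries the product topology, and finite products and countable disjoint sums carry the usual topologies) such that the partial function $w\mapsto F(w,g(G(w)))$ belongs to $P$ for every $g\in Q$. - $\mathrm{rDiv}$ (robust division) is the set of all functions $d:\{(u,v)\in\mathbb{N}^{\mathbb{N}}\times\mathbb{N}^{\mathbb{N}} : u,v \text{ are names and } 0\le\rho(u)\le\rho(v)\}\to\mathbb{N}^{\mathbb{N}}$ with $\rho(d(u,v))=\rho(u)/\rho(v)$ whenever $\rho(v)>0$; if $\rho(v)=0$, then $d(u,v)$ is arbitrary. - For $z\ge 1$, $\langle\mathrm{rDiv}\rangle^z=\{(x_1,\dots,x_z)\mapsto(d_1(x_1),\dots,d_z(x_z))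 : d_1,\dots,d_z\in\mathrm{rDiv}\}$ ($z$ parallel robust divisions). - For a countable family $(P_i)_{i\in I}$ of multi-valued functions, $\lceil P_i\rceil_{i\in I}$ is the set of all functions $(i,x)\mapsto(i,f_i(x))$ with $f_i\in P_i$ for each $i \in I$, on the disjoint sum of the domains. - For $n,m\in\mathbb{N}$, $\mathrm{BLinIneq}_{nm}$ is the multi-valued function whose domain consists of all families of names of the entries of a matrix $A\in\mathbb{R}^{n\times m}$ and a vector $b\in\mathbb{R}^n$ such that some $v\in[0,1]^m$ satisfies $Av\le b$ (componentwise), and whose admissible values are all $m$-tuples of names of the coordinates of some $v\in[0,1]^m$ with $Av\le b$. $\mathrm{BLinIneq}=\lceil\mathrm{BLinIneq}_{nm}\rceil_{n,m\in\mathbb{N}}$. Theorem. $\mathrm{BLinIneq}\le_2\lceil\langle\mathrm{rDiv}\rangle^z\rceil_{z\ge 1}$. -/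

import Mathlib

/-- Baire space `ℕ^ℕ` with the product topology; its elements serve as names of other objects. -/
abbrev Baire : Type := ℕ → ℕ

/-- `IsName ν w x` says `ρ(w) = x`: for the numbering `ν` of the rationals, the sequence `w`
is a `ρ`-name of the real number `x`, i.e. `|ν (w i) - x| ≤ 2 ^ (-i)` for all `i`. -/
def IsName (ν : ℕ ≃ ℚ) (w : Baire) (x : ℝ) : Prop :=
  ∀ i : ℕ, |((ν (w i) : ℚ) : ℝ) - x| ≤ (2 : ℝ)⁻¹ ^ i

/-- A multi-valued function, identified with the set of its choice functions. These are
partial functions from `X` to `Y`, each of them with the domain of the multi-valued function. -/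
abbrev MultiFun (X Y : Type) : Type := Set (X →. Y)

/-- The multi-valued function with domain `D` and admissible values `S x` at `x ∈ D`. -/
def choiceFunctions {X Y : Type} (D : Set X) (S : X → Set Y) : MultiFun X Y :=
  {f | f.Dom = D ∧ ∀ x, ∀ y ∈ f x, y ∈ S x}

/-- A partial function is continuous if it is continuous on its domain, where the domain (an
arbitrary set) carries the subspace topology. -/
def PartialContinuous {X Y : Type} [TopologicalSpace X] [TopologicalSpace Y]
    (f : X →. Y) : Prop :=
  Continuous f.asSubtype

/-- The partial function `w ↦ F (w, g (G w))`, with its natural domain. -/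
def composeOracle {X Y U V : Type} (F : X × V →. Y) (G : X →. U) (g : U →. V) : X →. Y :=
  fun w => (G w).bind fun u => (g u).bind fun y => F (w, y)

/-- Type-2-reducibility `A ≤₂ B`: there are continuous partial functions `F`, `G` such that
`w ↦ F (w, g (G w))` belongs to `A` for every `g ∈ B`. -/
def Type2Reducible {X Y U V : Type} [TopologicalSpace X] [TopologicalSpace Y]
    [TopologicalSpace U] [TopologicalSpace V] (A : MultiFun X Y) (B : MultiFun U V) : Prop :=
  ∃ (F : X × V →. Y) (G : X →. U), PartialContinuous F ∧ PartialContinuous G ∧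
    ∀ g ∈ B, composeOracle F G g ∈ A

/-- The product `⟨f₁, …, f_z⟩` of partial functions, `(x₁, …, x_z) ↦ (f₁ x₁, …, f_z x_z)`. -/
def prodFun {X Y : Type} {z : ℕ} (f : Fin z → (X →. Y)) : (Fin z → X) →. (Fin z → Y) :=
  fun x => ⟨∀ i, (f i (x i)).Dom, fun h i => (f i (x i)).get (h i)⟩

/-- The `z`-fold product `⟨P⟩^z = {⟨f₁, …, f_z⟩ | f₁, …, f_z ∈ P}`, i.e. `z` parallel instances
of `P`. -/
def power {X Y : Type} (P : MultiFun X Y) (z : ℕ) : MultiFun (Fin z → X) (Fin z → Y) :=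
  {h | ∃ f : Fin z → (X →. Y), (∀ i, f i ∈ P) ∧ h = prodFun f}

/-- The coproduct `(i, x) ↦ (i, f i x)` of partial functions. -/
def coprodFun {ι : Type} {X Y : ι → Type} (f : ∀ i, X i →. Y i) : (Σ i, X i) →. (Σ i, Y i) :=
  fun p => (f p.1 p.2).map (Sigma.mk p.1)

/-- The supremum `⌈P i⌉` of a family of multi-valued functions: an instance is an index `i`
together with an instance of `P i`, to be solved by `P i`. -/
def supremum {ι : Type} {X Y : ι → Type} (P : ∀ i, MultiFun (X i) (Y i)) :
    MultiFun (Σ i, X i) (Σ i, Y i) :=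
  {h | ∃ f : ∀ i, X i →. Y i, (∀ i, f i ∈ P i) ∧ h = coprodFun f}

/-- Robust division: the functions `d` defined on `{(u, v) | 0 ≤ ρ(u) ≤ ρ(v)}` that satisfy
`ρ(d (u, v)) = ρ(u) / ρ(v)` whenever `ρ(v) > 0`. There is no condition on the sequence
`d (u, v)` when `ρ(v) = 0`. -/
def rDiv (ν : ℕ ≃ ℚ) : MultiFun (Baire × Baire) Baire :=
  choiceFunctions
    {p | ∃ x y : ℝ, IsName ν p.1 x ∧ IsName ν p.2 y ∧ 0 ≤ x ∧ x ≤ y}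
    (fun p => {w | ∀ x y : ℝ, IsName ν p.1 x → IsName ν p.2 y → 0 < y → IsName ν w (x / y)})

/-- `v` solves the bounded system of linear inequalities `A v ≤ b`, `0 ≤ v ≤ 1`. -/
def IsBoundedSolution {n m : ℕ} (A : Matrix (Fin n) (Fin m) ℝ) (b : Fin n → ℝ)
    (v : Fin m → ℝ) : Prop :=
  (∀ i, A.mulVec v i ≤ b i) ∧ ∀ j, 0 ≤ v j ∧ v j ≤ 1

/-- `p` consists of a `ρ^{nm}`-name of the matrix `A` and a `ρ^n`-name of the vector `b`. -/
def IsSystemName (ν : ℕ ≃ ℚ) {n m : ℕ} (p : (Fin n → Fin m → Baire) × (Fin n → Baire))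
    (A : Matrix (Fin n) (Fin m) ℝ) (b : Fin n → ℝ) : Prop :=
  (∀ i j, IsName ν (p.1 i j) (A i j)) ∧ ∀ i, IsName ν (p.2 i) (b i)

/-- `BLinIneq` for `n` inequalities in `m` unknowns: from names of `A` and `b` such that
`A v ≤ b`, `0 ≤ v ≤ 1` has a solution, find a `ρ^m`-name of a solution. -/
def bLinIneqOfSize (ν : ℕ ≃ ℚ) (n m : ℕ) :
    MultiFun ((Fin n → Fin m → Baire) × (Fin n → Baire)) (Fin m → Baire) :=
  choiceFunctions
    {p | ∃ A b, IsSystemName ν p A b ∧ ∃ v, IsBoundedSolution A b v}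
    (fun p => {s | ∃ A b, IsSystemName ν p A b ∧
      ∃ v, IsBoundedSolution A b v ∧ ∀ j, IsName ν (s j) (v j)})

/-- `BLinIneq` without fixed numbers `n` of inequalities and `m` of unknowns. -/
def bLinIneq (ν : ℕ ≃ ℚ) :
    MultiFun
      (Σ nm : ℕ × ℕ, (Fin nm.1 → Fin nm.2 → Baire) × (Fin nm.1 → Baire))
      (Σ nm : ℕ × ℕ, Fin nm.2 → Baire) :=
  supremum fun nm : ℕ × ℕ => bLinIneqOfSize ν nm.1 nm.2

/-- The supremum over all `z ≥ 1` of `z` parallel robust divisions. -/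
def parallelRDiv (ν : ℕ ≃ ℚ) :
    MultiFun (Σ z : ℕ+, Fin z → Baire × Baire) (Σ z : ℕ+, Fin z → Baire) :=
  supremum fun z : ℕ+ => power (rDiv ν) z

/-!
For a system `θ = (A, b)` let `P θ` be the polytope of its solutions in the unit cube. A point of
`P θ` cannot be chosen continuously in `θ`, but `P θ` jumps only finitely often, in a controlled way.

*Strata.* If the rows in a set `T` have a nonsingular Gram matrix, then setting them to equality
(in the least squares sense) determines a basic point, and `P θ` is the convex hull of the feasible
basic points (`vertexFamily_sign_spec`). Which basic points exist and are feasible is read off from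
the signs of finitely many polynomials in `θ` (`feasibilityTest`). On the set `X i` where exactly
`i` of these polynomials vanish, all the signs are locally constant, hence `P θ` is the convex hull
of a finite family of points that is continuous on `X i` (`continuousOn_vertexFamily`).

*Generators near a stratum.* The set `Y i ⊇ X i` where at most `i` polynomials vanish is open. The
family extends from `X i` to a continuous family `v i` on `Y i`, and, since `P` has closed graph,
there is a continuous `η i` on `Y i`, zero on `X i`, such that `P θ` stays within distance
`η i θ` of the convex hull of `v i θ` (`exists_continuousOn_generators`). The elementary symmetric
polynomial `δ i` in the absolute values (`absEsymm`) is positive exactly on `Y i`, so the numerators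
`δ i * v i` and `δ i * η i` are continuous everywhere, and all the divisions by `δ i` can be asked
in parallel: the answers are `v i θ` and `η i θ` if `θ ∈ Y i`, and arbitrary otherwise.

*Recombination.* Given the answers, start anywhere and, for `i = 0, 1, 2, …`, move the current
point `x` to within distance `η i` of its nearest point in the convex hull of `v i`
(`iterateRetraction`). If `θ ∈ X s`, then the answers for `i < s` are arbitrary; step `s` lands in
`P θ`, whatever happened before; the later steps fix every point of `P θ`
(`iterateRetraction_mem`). This procedure is a continuous function of the answers alone.

It remains to pass from real numbers to names: reading off a real number extends to a continuous
total function `realOfName` on all sequences, so that answers which are not names do no harm, and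
continuous real functions have continuous realizers (`exists_continuous_isName`).
-/

open Set Filter Topology Pointwise

/-! ### Nearest points of convex hulls -/

/-- The convex hull of a finite family varies by at most as much as the family. -/
theorem exists_mem_convexHull_norm_sub_le {H K : Type*} [SeminormedAddCommGroup H]
    [NormedSpace ℝ H] [Fintype K] (c c' : K → H) {y : H} (hy : y ∈ convexHull ℝ (range c)) :
    ∃ z ∈ convexHull ℝ (range c'), ‖z - y‖ ≤ ‖c' - c‖ := by
  have hconv : Convex ℝ (convexHull ℝ (range c') + Metric.closedBall (0 : H) ‖c' - c‖) :=
    (convex_convexHull ℝ _).add (convex_closedBall _ _)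
  have hsub : range c ⊆ convexHull ℝ (range c') + Metric.closedBall (0 : H) ‖c' - c‖ := by
    rintro _ ⟨k, rfl⟩
    refine Set.mem_add.2 ⟨c' k, subset_convexHull ℝ _ (mem_range_self k), c k - c' k, ?_, by abel⟩
    rw [mem_closedBall_zero_iff, norm_sub_rev]
    exact norm_le_pi_norm (c' - c) k
  obtain ⟨z, hz, h, hh, rfl⟩ := Set.mem_add.1 (convexHull_min hsub hconv hy)
  refine ⟨z, hz, ?_⟩
  rw [sub_add_cancel_left, norm_neg]
  exact mem_closedBall_zero_iff.1 hh

/-- The nearest point of `convexHull ℝ (range c)` depends continuously on both the generating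
family `c` and the point `x`. -/
theorem exists_continuous_nearestPoint (H K : Type*) [NormedAddCommGroup H]
    [InnerProductSpace ℝ H] [Fintype K] [Nonempty K] :
    ∃ Ψ : (K → H) × H → H, Continuous Ψ ∧ ∀ c x, Ψ (c, x) ∈ convexHull ℝ (range c) ∧
      (x ∈ convexHull ℝ (range c) → Ψ (c, x) = x) := by
  have hex : ∀ p : (K → H) × H, ∃ y ∈ convexHull ℝ (range p.1),
      ‖p.2 - y‖ = ⨅ w : convexHull ℝ (range p.1), ‖p.2 - w‖ := fun p =>
    exists_norm_eq_iInf_of_complete_convex ((range_nonempty _).convexHull)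
      ((finite_range p.1).isCompact_convexHull ℝ).isComplete (convex_convexHull ℝ _) p.2
  choose Ψ hmem hmin using hex
  have hinner : ∀ p : (K → H) × H, ∀ w ∈ convexHull ℝ (range p.1),
      inner ℝ (p.2 - Ψ p) (w - Ψ p) ≤ 0 := fun p =>
    (norm_eq_iInf_iff_real_inner_le_zero (convex_convexHull ℝ _) (hmem p)).1 (hmin p)
  have hle : ∀ p : (K → H) × H, ∀ w ∈ convexHull ℝ (range p.1), ‖p.2 - Ψ p‖ ≤ ‖p.2 - w‖ := by
    intro p w hw
    rw [hmin p]
    exact ciInf_le (f := fun w : convexHull ℝ (range p.1) => ‖p.2 - (w : H)‖)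
      ⟨0, by rintro _ ⟨w, rfl⟩; exact norm_nonneg _⟩ ⟨w, hw⟩
  obtain ⟨k⟩ := ‹Nonempty K›
  -- the variational inequalities at `p` and `q` give a Hölder estimate of exponent `1 / 2`
  have hest : ∀ p q : (K → H) × H, ‖Ψ q - Ψ p‖ ^ 2 ≤
      ‖q.2 - p.2‖ ^ 2 + 2 * ‖q.1 - p.1‖ * (‖p.2 - Ψ p‖ + ‖q.2 - q.1 k‖) := by
    intro p q
    obtain ⟨z, hz, hzq⟩ := exists_mem_convexHull_norm_sub_le q.1 p.1 (hmem q)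
    obtain ⟨z', hz', hzp⟩ := exists_mem_convexHull_norm_sub_le p.1 q.1 (hmem p)
    rw [norm_sub_rev p.1] at hzq
    have h1 : inner ℝ (p.2 - Ψ p) (Ψ q - Ψ p) ≤ ‖p.2 - Ψ p‖ * ‖q.1 - p.1‖ := by
      have e : inner ℝ (p.2 - Ψ p) (Ψ q - Ψ p) =
          inner ℝ (p.2 - Ψ p) (z - Ψ p) - inner ℝ (p.2 - Ψ p) (z - Ψ q) := by
        rw [← inner_sub_right]; congr 1; abel
      have := hinner p z hz
      have h2 := neg_le_of_abs_le ((abs_real_inner_le_norm (p.2 - Ψ p) (z - Ψ q)).trans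
        (mul_le_mul_of_nonneg_left hzq (norm_nonneg _)))
      linarith
    have h2 : inner ℝ (q.2 - Ψ q) (Ψ p - Ψ q) ≤ ‖q.2 - q.1 k‖ * ‖q.1 - p.1‖ := by
      have e : inner ℝ (q.2 - Ψ q) (Ψ p - Ψ q) =
          inner ℝ (q.2 - Ψ q) (z' - Ψ q) - inner ℝ (q.2 - Ψ q) (z' - Ψ p) := by
        rw [← inner_sub_right]; congr 1; abel
      have := hinner q z' hz'
      have h2 := neg_le_of_abs_le ((abs_real_inner_le_norm (q.2 - Ψ q) (z' - Ψ p)).trans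
        (mul_le_mul (hle q _ (subset_convexHull ℝ _ (mem_range_self k))) hzp (norm_nonneg _)
          (norm_nonneg _)))
      linarith
    have h3 : ‖Ψ q - Ψ p‖ ^ 2 = inner ℝ (q.2 - p.2) (Ψ q - Ψ p)
        + inner ℝ (p.2 - Ψ p) (Ψ q - Ψ p) + inner ℝ (q.2 - Ψ q) (Ψ p - Ψ q) := by
      have e : inner ℝ (q.2 - Ψ q) (Ψ p - Ψ q) = - inner ℝ (q.2 - Ψ q) (Ψ q - Ψ p) := by
        rw [← inner_neg_right]; congr 1; abel
      rw [e, ← real_inner_self_eq_norm_sq, ← inner_add_left, ← sub_eq_add_neg, ← inner_sub_left]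
      congr 1; abel
    have h4 := real_inner_le_norm (q.2 - p.2) (Ψ q - Ψ p)
    nlinarith [sq_nonneg (‖q.2 - p.2‖ - ‖Ψ q - Ψ p‖)]
  refine ⟨Ψ, continuous_iff_continuousAt.2 fun p => ?_, fun c x => ⟨hmem (c, x), fun hx => ?_⟩⟩
  · have hlim : Tendsto (fun q : (K → H) × H => ‖q.2 - p.2‖ ^ 2
        + 2 * ‖q.1 - p.1‖ * (‖p.2 - Ψ p‖ + ‖q.2 - q.1 k‖)) (𝓝 p) (𝓝 0) := by
      have : Continuous fun q : (K → H) × H => ‖q.2 - p.2‖ ^ 2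
        + 2 * ‖q.1 - p.1‖ * (‖p.2 - Ψ p‖ + ‖q.2 - q.1 k‖) := by fun_prop
      simpa using this.tendsto p
    have hsq := squeeze_zero (fun q => sq_nonneg _) (hest p) hlim
    have := hsq.sqrt
    simp only [Real.sqrt_sq (norm_nonneg _), Real.sqrt_zero] at this
    exact tendsto_iff_norm_sub_tendsto_zero.2 this
  · have := hle (c, x) x hx
    simp only [sub_self, norm_zero, norm_le_zero_iff] at this
    exact (sub_eq_zero.1 this).symm

/-- The nearest point map of the Euclidean norm, transported to `Fin m → ℝ` with its sup norm. -/
theorem exists_continuous_convexHull_retraction (m : ℕ) (K : Type*) [Fintype K] [Nonempty K] :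
    ∃ Ψ : (K → Fin m → ℝ) × (Fin m → ℝ) → (Fin m → ℝ), Continuous Ψ ∧
      ∀ c x, Ψ (c, x) ∈ convexHull ℝ (range c) ∧
        (x ∈ convexHull ℝ (range c) → Ψ (c, x) = x) := by
  obtain ⟨Ψ, hΨ, h⟩ := exists_continuous_nearestPoint (EuclideanSpace ℝ (Fin m)) K
  set e := EuclideanSpace.equiv (Fin m) ℝ
  have himg : ∀ c : K → Fin m → ℝ,
      e '' convexHull ℝ (range fun k => e.symm (c k)) = convexHull ℝ (range c) := by
    intro c
    have := e.toLinearEquiv.toLinearMap.image_convexHull (range fun k => e.symm (c k))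
    rw [← range_comp] at this
    simpa [Function.comp_def] using this
  refine ⟨fun p => e (Ψ (fun k => e.symm (p.1 k), e.symm p.2)), ?_, fun c x => ⟨?_, fun hx => ?_⟩⟩
  · fun_prop
  · rw [← himg]
    exact mem_image_of_mem _ (h _ _).1
  · rw [← himg] at hx
    obtain ⟨y, hy, rfl⟩ := hx
    simp only [ContinuousLinearEquiv.symm_apply_apply]
    rw [(h _ _).2 hy]

/-! ### Extending generators of a family of convex sets -/

/-- The point `y` plus the coordinatewise truncation of `x - y` to `[-r, r]`, i.e. a point nearest
to `x` within sup-distance `r ≥ 0` of `y`. -/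
def moveTowards {m : ℕ} (r : ℝ) (y x : Fin m → ℝ) : Fin m → ℝ :=
  fun j => y j + max (-r) (min r (x j - y j))

theorem moveTowards_zero {m : ℕ} (y x : Fin m → ℝ) : moveTowards 0 y x = y := by
  funext j
  simp [moveTowards]

theorem moveTowards_eq_of_abs_le {m : ℕ} {r : ℝ} {y x : Fin m → ℝ}
    (h : ∀ j, |x j - y j| ≤ r) : moveTowards r y x = x := by
  funext j
  obtain ⟨h1, h2⟩ := abs_le.1 (h j)
  simp [moveTowards, min_eq_right h2, max_eq_right h1]

theorem continuous_moveTowards {X : Type*} [TopologicalSpace X] {m : ℕ} {r : X → ℝ}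
    {y x : X → Fin m → ℝ} (hr : Continuous r) (hy : Continuous y) (hx : Continuous x) :
    Continuous fun t => moveTowards (r t) (y t) (x t) := by
  unfold moveTowards
  fun_prop

/-- If `π` fixes the points of `Q y` for `y ∈ X`, then the displacement of the points of `Q y` by
`π` is bounded by a continuous function of `y` that vanishes on `X`. The bound is a series of Urysohn
functions: since `Q` is a closed family in a compact cube, the `y` with some point of `Q y` displaced
by at least `2⁻¹ ^ k` form a closed set, disjoint from `X`. -/
theorem exists_continuous_modulus {Y : Type*} [TopologicalSpace Y] [NormalSpace Y] {m : ℕ}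
    {Q : Y → Set (Fin m → ℝ)} {X : Set Y} (hX : IsClosed X)
    (hQ : IsClosed {p : Y × (Fin m → ℝ) | p.2 ∈ Q p.1})
    (hcube : ∀ y, ∀ x ∈ Q y, ∀ j, 0 ≤ x j ∧ x j ≤ 1)
    {π : Y × (Fin m → ℝ) → Fin m → ℝ} (hπ : Continuous π)
    (hπX : ∀ y ∈ X, ∀ x ∈ Q y, π (y, x) = x)
    (hπcube : ∀ y, ∀ x ∈ Q y, ∀ j, |x j - π (y, x) j| ≤ 1) :
    ∃ η : Y → ℝ, Continuous η ∧ (∀ y, 0 ≤ η y ∧ η y ≤ 1) ∧ (∀ y ∈ X, η y = 0) ∧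
      ∀ y, ∀ x ∈ Q y, ∀ j, |x j - π (y, x) j| ≤ η y := by
  let bad : ℕ → Set (Y × (Fin m → ℝ)) := fun k =>
    {p | p.2 ∈ Q p.1 ∧ ∃ j, (2 : ℝ)⁻¹ ^ k ≤ |p.2 j - π p j|}
  have hbad : ∀ k, IsClosed (bad k) := by
    intro k
    refine hQ.inter ?_
    have : {p : Y × (Fin m → ℝ) | ∃ j, (2 : ℝ)⁻¹ ^ k ≤ |p.2 j - π p j|} =
        ⋃ j, {p : Y × (Fin m → ℝ) | (2 : ℝ)⁻¹ ^ k ≤ |p.2 j - π p j|} := by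
      ext p; simp
    change IsClosed {p : Y × (Fin m → ℝ) | ∃ j, (2 : ℝ)⁻¹ ^ k ≤ |p.2 j - π p j|}
    rw [this]
    exact isClosed_iUnion_of_finite fun j => isClosed_le (by fun_prop) (by fun_prop)
  let V : ℕ → Set Y := fun k => Prod.fst '' bad k
  have hV : ∀ k, IsClosed (V k) := by
    intro k
    have hcomp : CompactSpace (Icc (0 : Fin m → ℝ) 1) := isCompact_iff_compactSpace.1 isCompact_Icc
    have hcl : IsClosed {p : Y × Icc (0 : Fin m → ℝ) 1 | (p.1, (p.2 : Fin m → ℝ)) ∈ bad k} :=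
      (hbad k).preimage (by fun_prop)
    convert isClosedMap_fst_of_compactSpace _ hcl using 1
    ext y
    constructor
    · rintro ⟨⟨y, x⟩, hp, rfl⟩
      exact ⟨(y, ⟨x, fun j => (hcube y x hp.1 j).1, fun j => (hcube y x hp.1 j).2⟩), hp, rfl⟩
    · rintro ⟨p, hp, rfl⟩
      exact ⟨_, hp, rfl⟩
  have hdisj : ∀ k, Disjoint X (V k) := by
    intro k
    rw [Set.disjoint_left]
    rintro y hy ⟨⟨y, x⟩, ⟨hx, j, hj⟩, rfl⟩
    rw [hπX y hy x hx, sub_self, abs_zero] at hj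
    exact absurd hj (not_le.2 (by positivity))
  choose φ hφ0 hφ1 hφ using fun k => exists_continuous_zero_one_of_isClosed hX (hV k) (hdisj k)
  have hsum : Summable fun k : ℕ => (2 : ℝ)⁻¹ ^ k :=
    summable_geometric_of_lt_one (by norm_num) (by norm_num)
  have hnorm : ∀ k y, ‖(2 : ℝ)⁻¹ ^ k * φ k y‖ ≤ (2 : ℝ)⁻¹ ^ k := by
    intro k y
    rw [Real.norm_of_nonneg (mul_nonneg (by positivity) (hφ k y).1)]
    exact mul_le_of_le_one_right (by positivity) (hφ k y).2
  have hnn : ∀ k y, 0 ≤ (2 : ℝ)⁻¹ ^ k * φ k y := fun k y =>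
    mul_nonneg (by positivity) (hφ k y).1
  have hsummable : ∀ y, Summable fun k => (2 : ℝ)⁻¹ ^ k * φ k y := fun y =>
    Summable.of_norm_bounded hsum fun k => hnorm k y
  refine ⟨fun y => min 1 (∑' k, (2 : ℝ)⁻¹ ^ k * φ k y), ?_, fun y => ⟨?_, min_le_left _ _⟩, ?_, ?_⟩
  · exact continuous_const.min (continuous_tsum (fun k => by fun_prop) hsum hnorm)
  · exact le_min zero_le_one (tsum_nonneg fun k => hnn k y)
  · intro y hy
    have : ∀ k, φ k y = 0 := fun k => hφ0 k hy
    simp [this]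
  · intro y x hx j
    refine le_min (hπcube y x hx j) ?_
    set d := |x j - π (y, x) j| with hd
    rcases (abs_nonneg (x j - π (y, x) j)).eq_or_lt with h0 | hpos
    · rw [← hd] at h0
      rw [← h0]
      exact tsum_nonneg fun k => hnn k y
    rw [← hd] at hpos
    have hk : ∃ k : ℕ, (2 : ℝ)⁻¹ ^ k ≤ d := by
      obtain ⟨k, hk⟩ := exists_pow_lt_of_lt_one hpos (by norm_num : (2 : ℝ)⁻¹ < 1)
      exact ⟨k, hk.le⟩
    classical
    -- all summands from the first scale `2⁻¹ ^ k ≤ d` on are full, and they add up to `2 * 2⁻¹ ^ k`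
    have hmem : ∀ i, φ (i + Nat.find hk) y = 1 := by
      intro i
      refine hφ1 _ ⟨(y, x), ⟨hx, j, ?_⟩, rfl⟩
      exact (pow_le_pow_of_le_one (by norm_num) (by norm_num) (Nat.le_add_left _ _)).trans
        (Nat.find_spec hk)
    have htail : ∑' i : ℕ, (2 : ℝ)⁻¹ ^ (i + Nat.find hk) * φ (i + Nat.find hk) y =
        2 * (2 : ℝ)⁻¹ ^ Nat.find hk := by
      simp only [hmem, mul_one, pow_add]
      rw [tsum_mul_right, tsum_geometric_of_lt_one (by norm_num) (by norm_num)]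
      norm_num
    have hsplit := (hsummable y).sum_add_tsum_nat_add (Nat.find hk)
    rw [htail] at hsplit
    have hge : 2 * (2 : ℝ)⁻¹ ^ Nat.find hk ≤ ∑' k, (2 : ℝ)⁻¹ ^ k * φ k y := by
      rw [← hsplit]
      exact le_add_of_nonneg_left (Finset.sum_nonneg fun k _ => hnn k y)
    refine le_trans ?_ hge
    rcases Nat.eq_zero_or_pos (Nat.find hk) with h | h
    · have := hπcube y x hx j
      rw [h, pow_zero]
      linarith
    · have := Nat.find_min hk (Nat.sub_lt h one_pos)
      obtain ⟨k, hk'⟩ := Nat.exists_eq_succ_of_ne_zero h.ne'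
      rw [hk'] at this ⊢
      rw [Nat.succ_sub_one, not_le] at this
      rw [pow_succ]
      linarith

theorem convexHull_range_subset_Icc {m : ℕ} {K : Type*} {v : K → Fin m → ℝ}
    (hv : ∀ k j, 0 ≤ v k j ∧ v k j ≤ 1) : convexHull ℝ (range v) ⊆ Icc 0 1 := by
  refine convexHull_min ?_ (convex_Icc 0 1)
  rintro _ ⟨k, rfl⟩
  exact ⟨fun j => (hv k j).1, fun j => (hv k j).2⟩

/-- Let `Q` be a closed family of subsets of the unit cube, and let `v₀` be a continuous family
of finitely many points on a relatively closed set `X ⊆ Y` with `Q ⊆ convexHull v₀` on `X`. Then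
`v₀` extends to `Y`, together with an error bound `η` vanishing on `X` that controls the distance
of the points of `Q` from the convex hull. -/
theorem exists_continuousOn_generators {E : Type*} [TopologicalSpace E]
    [TopologicalSpace.MetrizableSpace E] {m : ℕ} {K : Type*} [Fintype K] [Nonempty K]
    {Q : E → Set (Fin m → ℝ)} {X Y : Set E} (hXY : X ⊆ Y)
    (hX : ∃ Z, IsClosed Z ∧ X = Y ∩ Z)
    (hQ : IsClosed {p : E × (Fin m → ℝ) | p.2 ∈ Q p.1})
    (hcube : ∀ y, ∀ x ∈ Q y, ∀ j, 0 ≤ x j ∧ x j ≤ 1)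
    {Ψ : (K → Fin m → ℝ) × (Fin m → ℝ) → Fin m → ℝ} (hΨ : Continuous Ψ)
    (hΨmem : ∀ c x, Ψ (c, x) ∈ convexHull ℝ (range c))
    (hΨid : ∀ c x, x ∈ convexHull ℝ (range c) → Ψ (c, x) = x)
    {v₀ : E → K → Fin m → ℝ} (hv₀ : ContinuousOn v₀ X)
    (hv₀cube : ∀ y ∈ X, ∀ k j, 0 ≤ v₀ y k j ∧ v₀ y k j ≤ 1)
    (hv₀Q : ∀ y ∈ X, Q y ⊆ convexHull ℝ (range (v₀ y))) :
    ∃ (v : E → K → Fin m → ℝ) (η : E → ℝ), ContinuousOn v Y ∧ ContinuousOn η Y ∧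
      (∀ y k j, 0 ≤ v y k j ∧ v y k j ≤ 1) ∧ (∀ y, 0 ≤ η y ∧ η y ≤ 1) ∧
      (∀ y ∈ X, v y = v₀ y ∧ η y = 0) ∧
      ∀ y ∈ Y, ∀ x ∈ Q y, moveTowards (η y) (Ψ (v y, x)) x = x := by
  classical
  obtain ⟨Z, hZ, rfl⟩ := hX
  let A : Set Y := Subtype.val ⁻¹' Z
  have hA : IsClosed A := hZ.preimage continuous_subtype_val
  let f : C(A, K → Fin m → ℝ) := ⟨fun a => v₀ a.1.1,
    hv₀.comp_continuous (by fun_prop) fun a => ⟨a.1.2, a.2⟩⟩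
  obtain ⟨g, hg⟩ := ContinuousMap.exists_restrict_eq hA f
  let w : Y → K → Fin m → ℝ := fun y k j => max 0 (min 1 (g y k j))
  have hw : Continuous w := by fun_prop
  have hwcube : ∀ y k j, 0 ≤ w y k j ∧ w y k j ≤ 1 := fun y k j =>
    ⟨le_max_left _ _, max_le zero_le_one (min_le_left _ _)⟩
  have hwA : ∀ y ∈ A, w y = v₀ y := by
    intro y hy
    have hgy : g y = v₀ y := DFunLike.congr_fun hg ⟨y, hy⟩
    funext k j
    obtain ⟨h0, h1⟩ := hv₀cube y ⟨y.2, hy⟩ k j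
    simp only [w, hgy, min_eq_right h1, max_eq_right h0]
  obtain ⟨η, hη, hη01, hηA, hηQ⟩ := exists_continuous_modulus (Y := Y) (Q := fun y => Q y) hA
    (hQ.preimage (f := fun p : Y × (Fin m → ℝ) => ((p.1 : E), p.2)) (by fun_prop))
    (fun y => hcube y) (π := fun p => Ψ (w p.1, p.2)) (by fun_prop)
    (fun y hy x hx => hΨid _ _ (by rw [hwA y hy]; exact hv₀Q y ⟨y.2, hy⟩ hx))
    (fun y x hx j => by
      have h := convexHull_range_subset_Icc (hwcube y) (hΨmem (w y) x)
      have h0 := h.1 j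
      have h1 := h.2 j
      have := hcube y x hx j
      simp only [Pi.zero_apply, Pi.one_apply] at h0 h1
      rw [abs_le]
      constructor <;> linarith)
  refine ⟨fun y => if h : y ∈ Y then w ⟨y, h⟩ else 0, fun y => if h : y ∈ Y then η ⟨y, h⟩ else 0,
    ?_, ?_, ?_, ?_, ?_, ?_⟩
  · rw [continuousOn_iff_continuous_domRestrict]
    convert hw using 1
    funext y
    simp
  · rw [continuousOn_iff_continuous_domRestrict]
    convert hη using 1
    funext y
    simp
  · intro y k j
    dsimp only
    split_ifs with h
    · exact hwcube _ k j
    · simp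
  · intro y
    dsimp only
    split_ifs with h
    · exact hη01 _
    · simp
  · rintro y ⟨hy, hyZ⟩
    simp only [hy, dif_pos]
    exact ⟨hwA ⟨y, hy⟩ hyZ, hηA ⟨y, hy⟩ hyZ⟩
  · intro y hy x hx
    simp only [hy, dif_pos]
    exact moveTowards_eq_of_abs_le (hηQ ⟨y, hy⟩ x hx)

/-! ### Vertices of polyhedra -/

/-- The solution set of the system `B v ≤ c`. -/
def polyhedron {ρ : Type*} {m : ℕ} (B : ρ → Fin m → ℝ) (c : ρ → ℝ) : Set (Fin m → ℝ) :=
  {v | ∀ i, B i ⬝ᵥ v ≤ c i}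

/-- The matrix `∑ Bᵢᵀ Bᵢ` over the rows `i ∈ T`. It is nonsingular if and only if these rows span,
which makes it unnecessary to select a square submatrix. -/
def rowGram {ρ : Type*} {m : ℕ} (B : ρ → Fin m → ℝ) (T : Finset ρ) :
    Matrix (Fin m) (Fin m) ℝ :=
  ∑ i ∈ T, Matrix.vecMulVec (B i) (B i)

/-- The numerators of `basicPoint`, over the denominator `det (rowGram B T)`. -/
def basicNumerator {ρ : Type*} {m : ℕ} (B : ρ → Fin m → ℝ) (c : ρ → ℝ) (T : Finset ρ) :
    Fin m → ℝ :=
  (rowGram B T).adjugate.mulVec (∑ i ∈ T, c i • B i)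

/-- The least squares solution of the equations `Bᵢ v = cᵢ`, `i ∈ T`. The definition is meaningful
only if `det (rowGram B T) ≠ 0`. -/
noncomputable def basicPoint {ρ : Type*} {m : ℕ} (B : ρ → Fin m → ℝ) (c : ρ → ℝ)
    (T : Finset ρ) : Fin m → ℝ :=
  (rowGram B T).det⁻¹ • basicNumerator B c T

/-- The slack of the `i`-th inequality at `basicPoint B c T`, times `det (rowGram B T) ^ 2`: this
makes it a polynomial in `(B, c)`, without a change of sign. -/
def scaledSlack {ρ : Type*} {m : ℕ} (B : ρ → Fin m → ℝ) (c : ρ → ℝ) (T : Finset ρ) (i : ρ) : ℝ :=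
  (rowGram B T).det * ((rowGram B T).det * c i - B i ⬝ᵥ basicNumerator B c T)

section

variable {ρ : Type*} {m : ℕ} {B : ρ → Fin m → ℝ} {c : ρ → ℝ}

theorem convex_polyhedron : Convex ℝ (polyhedron B c) := by
  intro x hx y hy a b ha hb hab i
  have h1 := mul_le_mul_of_nonneg_left (hx i) ha
  have h2 := mul_le_mul_of_nonneg_left (hy i) hb
  rw [dotProduct_add, dotProduct_smul, dotProduct_smul, smul_eq_mul, smul_eq_mul]
  calc _ ≤ a * c i + b * c i := add_le_add h1 h2
    _ = c i := by rw [← add_mul, hab, one_mul]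

theorem isClosed_polyhedron : IsClosed (polyhedron B c) := by
  have : polyhedron B c = ⋂ i, {v | B i ⬝ᵥ v ≤ c i} := by ext; simp [polyhedron]
  rw [this]
  exact isClosed_iInter fun i => isClosed_le
    (Continuous.dotProduct continuous_const continuous_id) continuous_const

theorem rowGram_mulVec (T : Finset ρ) (d : Fin m → ℝ) :
    (rowGram B T).mulVec d = ∑ i ∈ T, (B i ⬝ᵥ d) • B i := by
  rw [rowGram, Matrix.sum_mulVec]
  refine Finset.sum_congr rfl fun i _ => ?_
  rw [Matrix.vecMulVec_mulVec, op_smul_eq_smul]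

theorem det_rowGram_ne_zero {T : Finset ρ} (h : ∀ d, (∀ i ∈ T, B i ⬝ᵥ d = 0) → d = 0) :
    (rowGram B T).det ≠ 0 := by
  intro h0
  obtain ⟨d, hd, hGd⟩ := Matrix.exists_mulVec_eq_zero_iff.2 h0
  refine hd (h d ?_)
  have h1 : d ⬝ᵥ (rowGram B T).mulVec d = ∑ i ∈ T, (B i ⬝ᵥ d) ^ 2 := by
    rw [rowGram_mulVec, dotProduct_sum]
    refine Finset.sum_congr rfl fun i _ => ?_
    rw [dotProduct_smul, smul_eq_mul, dotProduct_comm d, sq]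
  rw [hGd, dotProduct_zero] at h1
  intro i hi
  exact pow_eq_zero_iff two_ne_zero |>.1
    ((Finset.sum_eq_zero_iff_of_nonneg fun i _ => sq_nonneg _).1 h1.symm i hi)

theorem basicPoint_eq_of_tight {T : Finset ρ} (hT : (rowGram B T).det ≠ 0) {x : Fin m → ℝ}
    (hx : ∀ i ∈ T, B i ⬝ᵥ x = c i) : basicPoint B c T = x := by
  have h : ∑ i ∈ T, c i • B i = (rowGram B T).mulVec x := by
    rw [rowGram_mulVec]
    exact Finset.sum_congr rfl fun i hi => by rw [hx i hi]
  rw [basicPoint, basicNumerator, h, Matrix.mulVec_mulVec, Matrix.adjugate_mul, Matrix.smul_mulVec,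
    Matrix.one_mulVec, smul_smul, inv_mul_cancel₀ hT, one_smul]

theorem basicPoint_mem_iff {T : Finset ρ} (hT : (rowGram B T).det ≠ 0) :
    basicPoint B c T ∈ polyhedron B c ↔ ∀ i, 0 ≤ scaledSlack B c T i := by
  refine forall_congr' fun i => ?_
  have h : scaledSlack B c T i =
      (rowGram B T).det ^ 2 * (c i - B i ⬝ᵥ basicPoint B c T) := by
    rw [scaledSlack, basicPoint, dotProduct_smul, smul_eq_mul]
    field_simp
  rw [h, mul_nonneg_iff_of_pos_left (by positivity), sub_nonneg]

/-- The constraints that are tight at an extreme point determine it. -/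
theorem exists_basicPoint_of_mem_extremePoints [Fintype ρ] {x : Fin m → ℝ}
    (hx : x ∈ (polyhedron B c).extremePoints ℝ) :
    ∃ T : Finset ρ, (rowGram B T).det ≠ 0 ∧ basicPoint B c T = x := by
  classical
  let T : Finset ρ := Finset.univ.filter fun i => B i ⬝ᵥ x = c i
  have hxT : ∀ i ∈ T, B i ⬝ᵥ x = c i := fun i hi => (Finset.mem_filter.1 hi).2
  have hT : (rowGram B T).det ≠ 0 := by
    refine det_rowGram_ne_zero fun d hd => ?_
    have hev : ∀ᶠ t in 𝓝 (0 : ℝ), ∀ i, B i ⬝ᵥ (x + t • d) ≤ c i := by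
      rw [eventually_all]
      intro i
      by_cases hi : B i ⬝ᵥ x = c i
      · refine Eventually.of_forall fun t => ?_
        rw [dotProduct_add, dotProduct_smul, hd i (by simp [T, hi]), smul_zero, add_zero, hi]
      · have hcont : Continuous fun t : ℝ => B i ⬝ᵥ (x + t • d) := by
          simp only [dotProduct]
          fun_prop
        have hlt : B i ⬝ᵥ (x + (0 : ℝ) • d) < c i := by
          simpa using lt_of_le_of_ne (hx.1 i) hi
        filter_upwards [hcont.continuousAt.eventually_lt_const hlt] with t ht using ht.le
    have hneg : ∀ᶠ t in 𝓝 (0 : ℝ), ∀ i, B i ⬝ᵥ (x + (-t) • d) ≤ c i := by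
      have : Tendsto (fun t : ℝ => -t) (𝓝 0) (𝓝 0) := by simpa using (continuous_neg (G := ℝ)).tendsto 0
      exact this.eventually hev
    -- a direction `d` orthogonal to the tight rows would give a segment around `x`
    obtain ⟨t, ⟨h1, h2⟩, ht⟩ :=
      (((hev.and hneg).filter_mono nhdsWithin_le_nhds).and
        (self_mem_nhdsWithin : {(0 : ℝ)}ᶜ ∈ 𝓝[≠] 0)).exists
    have hseg : x ∈ openSegment ℝ (x + t • d) (x + (-t) • d) := by
      refine ⟨1 / 2, 1 / 2, by norm_num, by norm_num, by norm_num, ?_⟩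
      module
    have := hx.2 h1 h2 hseg
    simp only [add_eq_left, smul_eq_zero] at this
    exact this.resolve_left ht
  exact ⟨T, hT, basicPoint_eq_of_tight hT hxT⟩

theorem polyhedron_subset_convexHull [Fintype ρ] (hcpt : IsCompact (polyhedron B c))
    {S : Set (Fin m → ℝ)} (hfin : S.Finite)
    (hS : ∀ T, (rowGram B T).det ≠ 0 → basicPoint B c T ∈ polyhedron B c → basicPoint B c T ∈ S) :
    polyhedron B c ⊆ convexHull ℝ S := by
  rw [← closure_convexHull_extremePoints hcpt convex_polyhedron,
    ← (hfin.isClosed_convexHull ℝ).closure_eq]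
  refine closure_mono (convexHull_mono fun x hx => ?_)
  obtain ⟨T, hT, rfl⟩ := exists_basicPoint_of_mem_extremePoints hx
  exact hS T hT hx.1

end

section

variable {E : Type*} [TopologicalSpace E] {ρ : Type*} {m : ℕ} {B : E → ρ → Fin m → ℝ}
  {c : E → ρ → ℝ}

theorem continuous_rowGram (hB : Continuous B) (T : Finset ρ) :
    Continuous fun θ => rowGram (B θ) T := by
  simp only [rowGram]
  refine continuous_finsetSum _ fun i _ => Continuous.matrix_vecMulVec ?_ ?_ <;> fun_prop

theorem continuous_basicNumerator (hB : Continuous B) (hc : Continuous c) (T : Finset ρ) :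
    Continuous fun θ => basicNumerator (B θ) (c θ) T := by
  simp only [basicNumerator]
  exact (continuous_rowGram hB T).matrix_adjugate.matrix_mulVec (by fun_prop)

theorem continuousAt_basicPoint (hB : Continuous B) (hc : Continuous c) {T : Finset ρ} {θ : E}
    (h : (rowGram (B θ) T).det ≠ 0) :
    ContinuousAt (fun θ => basicPoint (B θ) (c θ) T) θ :=
  ((continuous_rowGram hB T).matrix_det.continuousAt.inv₀ h).smul
    (continuous_basicNumerator hB hc T).continuousAt

theorem continuous_scaledSlack (hB : Continuous B) (hc : Continuous c) (T : Finset ρ) (i : ρ) :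
    Continuous fun θ => scaledSlack (B θ) (c θ) T i := by
  simp only [scaledSlack]
  have h1 := (continuous_rowGram hB T).matrix_det
  have h2 := continuous_basicNumerator hB hc T
  have h3 : Continuous fun θ => B θ i ⬝ᵥ basicNumerator (B θ) (c θ) T :=
    Continuous.dotProduct (by fun_prop) h2
  fun_prop

theorem isClosed_setOf_mem_polyhedron (hB : Continuous B) (hc : Continuous c) :
    IsClosed {p : E × (Fin m → ℝ) | p.2 ∈ polyhedron (B p.1) (c p.1)} := by
  have : {p : E × (Fin m → ℝ) | p.2 ∈ polyhedron (B p.1) (c p.1)} =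
      ⋂ i, {p | B p.1 i ⬝ᵥ p.2 ≤ c p.1 i} := by
    ext; simp [polyhedron]
  rw [this]
  exact isClosed_iInter fun i => isClosed_le (Continuous.dotProduct (by fun_prop) (by fun_prop))
    (by fun_prop)

end

/-! ### Sign conditions for the vertices -/

/-- The polynomials whose signs determine which basic points of `(B, c)` exist and are feasible:
the index `(T, none)` stands for the determinant, `(T, some i)` for the slack of the inequality
`i`. -/
def feasibilityTest {ρ : Type*} {m : ℕ} (B : ρ → Fin m → ℝ) (c : ρ → ℝ) :
    Finset ρ × Option ρ → ℝ
  | (T, none) => (rowGram B T).det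
  | (T, some i) => scaledSlack B c T i

/-- According to the signs `s` of the polynomials, the basic point of `T` exists and is feasible. -/
def IsVertexIndex {ρ : Type*} (s : Finset ρ × Option ρ → SignType) (T : Finset ρ) : Prop :=
  s (T, none) ≠ 0 ∧ ∀ i, 0 ≤ s (T, some i)

open Classical in
/-- The basic points that exist and are feasible according to the signs `s`; the places of the
others are filled with one of these (with `0` if there are none). The signs are a separate argument
so that they can be held fixed while `B` and `c` vary. -/
noncomputable def vertexFamily {ρ : Type*} {m : ℕ} (s : Finset ρ × Option ρ → SignType)
    (B : ρ → Fin m → ℝ) (c : ρ → ℝ) (T : Finset ρ) : Fin m → ℝ :=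
  if IsVertexIndex s T then basicPoint B c T
  else if h : ∃ T₀, IsVertexIndex s T₀ then basicPoint B c h.choose else 0

theorem isVertexIndex_sign_iff {ρ : Type*} {m : ℕ} {B : ρ → Fin m → ℝ} {c : ρ → ℝ}
    {T : Finset ρ} : IsVertexIndex (fun j => SignType.sign (feasibilityTest B c j)) T ↔
      (rowGram B T).det ≠ 0 ∧ basicPoint B c T ∈ polyhedron B c := by
  unfold IsVertexIndex
  simp only [sign_ne_zero, sign_nonneg_iff, feasibilityTest]
  exact and_congr_right fun h => (basicPoint_mem_iff h).symm

theorem vertexFamily_sign_spec {ρ : Type*} [Fintype ρ] {m : ℕ} {B : ρ → Fin m → ℝ} {c : ρ → ℝ}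
    (hcpt : IsCompact (polyhedron B c)) (hne : (polyhedron B c).Nonempty) :
    convexHull ℝ (range (vertexFamily (fun j => SignType.sign (feasibilityTest B c j)) B c)) =
      polyhedron B c := by
  set s : Finset ρ × Option ρ → SignType := fun j => SignType.sign (feasibilityTest B c j)
  have hex : ∃ T₀, IsVertexIndex s T₀ := by
    obtain ⟨x, hx⟩ := hcpt.extremePoints_nonempty (E := Fin m → ℝ) hne
    obtain ⟨T, hT, rfl⟩ := exists_basicPoint_of_mem_extremePoints hx
    exact ⟨T, isVertexIndex_sign_iff.2 ⟨hT, hx.1⟩⟩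
  refine Subset.antisymm (convexHull_min ?_ convex_polyhedron)
    (polyhedron_subset_convexHull hcpt (finite_range _) fun T hT hmem => ⟨T, ?_⟩)
  · rintro _ ⟨T, rfl⟩
    unfold vertexFamily
    split_ifs with h
    · exact (isVertexIndex_sign_iff.1 h).2
    · exact (isVertexIndex_sign_iff.1 hex.choose_spec).2
  · rw [vertexFamily, if_pos (isVertexIndex_sign_iff.2 ⟨hT, hmem⟩)]

theorem vertexFamily_eq_zero {ρ : Type*} {m : ℕ} {B : ρ → Fin m → ℝ} {c : ρ → ℝ}
    (h : polyhedron B c = ∅) :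
    vertexFamily (fun j => SignType.sign (feasibilityTest B c j)) B c = 0 := by
  funext T
  have : ∀ T, ¬ IsVertexIndex (fun j => SignType.sign (feasibilityTest B c j)) T := by
    intro T hT
    have := (isVertexIndex_sign_iff.1 hT).2
    simp [h] at this
  simp [vertexFamily, this]

/-- The number of the functions `h · j` that vanish at `θ`. -/
noncomputable def zeroCount {J E : Type*} [Fintype J] (h : E → J → ℝ) (θ : E) : ℕ :=
  open Classical in (Finset.univ.filter fun j => h θ j = 0).card

theorem zeroCount_le_card {J E : Type*} [Fintype J] (h : E → J → ℝ) (θ : E) :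
    zeroCount h θ ≤ Fintype.card J :=
  Finset.card_le_univ _

/-- Nonzero values keep their sign nearby. -/
theorem eventually_sign_eq_of_ne_zero {J E : Type*} [Finite J] [TopologicalSpace E] {h : E → J → ℝ}
    (hh : Continuous h) (θ₀ : E) : ∀ᶠ θ in 𝓝 θ₀, ∀ j, h θ₀ j ≠ 0 →
      SignType.sign (h θ j) = SignType.sign (h θ₀ j) := by
  rw [eventually_all]
  intro j
  by_cases h0 : h θ₀ j = 0
  · simp [h0]
  have hj : Continuous fun θ => h θ j := by fun_prop
  rcases lt_or_gt_of_ne h0 with hlt | hgt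
  · filter_upwards [hj.continuousAt.eventually_lt_const hlt] with θ hθ _
    rw [sign_neg hθ, sign_neg hlt]
  · filter_upwards [hj.continuousAt.eventually_const_lt hgt] with θ hθ _
    rw [sign_pos hθ, sign_pos hgt]

theorem isOpen_zeroCount_le {J E : Type*} [Fintype J] [TopologicalSpace E] {h : E → J → ℝ}
    (hh : Continuous h) (k : ℕ) : IsOpen {θ | zeroCount h θ ≤ k} := by
  classical
  rw [isOpen_iff_mem_nhds]
  intro θ₀ hθ₀
  filter_upwards [eventually_sign_eq_of_ne_zero hh θ₀] with θ hθ
  refine le_trans (Finset.card_le_card fun j hj => ?_) hθ₀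
  simp only [Finset.mem_filter, Finset.mem_univ, true_and] at hj ⊢
  by_contra hne
  have := hθ j hne
  rw [hj, sign_zero, eq_comm, sign_eq_zero_iff] at this
  exact hne this

/-- On the set where exactly `k` of the functions vanish, all signs are locally constant. -/
theorem eventually_sign_eq {J E : Type*} [Fintype J] [TopologicalSpace E] {h : E → J → ℝ}
    (hh : Continuous h) (θ₀ : E) : ∀ᶠ θ in 𝓝[{θ | zeroCount h θ = zeroCount h θ₀}] θ₀,
      (fun j => SignType.sign (h θ j)) = fun j => SignType.sign (h θ₀ j) := by
  classical
  filter_upwards [(eventually_sign_eq_of_ne_zero hh θ₀).filter_mono nhdsWithin_le_nhds,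
    self_mem_nhdsWithin] with θ hθ hcard
  have hsub : (Finset.univ.filter fun j => h θ j = 0) ⊆ Finset.univ.filter fun j => h θ₀ j = 0 := by
    intro j hj
    simp only [Finset.mem_filter, Finset.mem_univ, true_and] at hj ⊢
    by_contra hne
    have := hθ j hne
    rw [hj, sign_zero, eq_comm, sign_eq_zero_iff] at this
    exact hne this
  have heq := Finset.eq_of_subset_of_card_le hsub (le_of_eq (Eq.symm hcard))
  funext j
  by_cases h0 : h θ₀ j = 0
  · have : j ∈ Finset.univ.filter fun j => h θ j = 0 := by
      rw [heq]; simp [h0]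
    rw [(Finset.mem_filter.1 this).2, h0]
  · exact hθ j h0

theorem continuous_feasibilityTest {E : Type*} [TopologicalSpace E] {ρ : Type*} {m : ℕ}
    {B : E → ρ → Fin m → ℝ} {c : E → ρ → ℝ} (hB : Continuous B) (hc : Continuous c) :
    Continuous fun θ => feasibilityTest (B θ) (c θ) := by
  refine continuous_pi fun j => ?_
  rcases j with ⟨T, _ | i⟩
  · exact (continuous_rowGram hB T).matrix_det
  · exact continuous_scaledSlack hB hc T i

theorem continuousOn_vertexFamily {E : Type*} [TopologicalSpace E] {ρ : Type*} [Fintype ρ] {m : ℕ}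
    {B : E → ρ → Fin m → ℝ} {c : E → ρ → ℝ} (hB : Continuous B) (hc : Continuous c) (k : ℕ) :
    ContinuousOn (fun θ => vertexFamily
        (fun j => SignType.sign (feasibilityTest (B θ) (c θ) j)) (B θ) (c θ))
      {θ | zeroCount (fun θ => feasibilityTest (B θ) (c θ)) θ = k} := by
  have htest := continuous_feasibilityTest hB hc
  rintro θ₀ rfl
  set s := fun j => SignType.sign (feasibilityTest (B θ₀) (c θ₀) j) with hs
  have hfix : ContinuousAt (fun θ => vertexFamily s (B θ) (c θ)) θ₀ := by
    refine continuousAt_pi.2 fun T => ?_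
    unfold vertexFamily
    split_ifs with h h
    · exact continuousAt_basicPoint hB hc (isVertexIndex_sign_iff.1 h).1
    · exact continuousAt_basicPoint hB hc (isVertexIndex_sign_iff.1 h.choose_spec).1
    · exact continuousAt_const
  refine hfix.continuousWithinAt.congr_of_eventuallyEq ?_ rfl
  filter_upwards [eventually_sign_eq htest θ₀] with θ hθ
  simp only [hθ, hs]

/-! ### Selecting a point by parallel divisions -/

/-- Starting from `0`, step `i` moves the current point to within distance `(a i).1` of its image
under `Ψ`, the retraction to the convex hull of `(a i).2`. -/
noncomputable def iterateRetraction {K : Type*} {m : ℕ}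
    (Ψ : (K → Fin m → ℝ) × (Fin m → ℝ) → Fin m → ℝ) (a : ℕ → ℝ × (K → Fin m → ℝ)) :
    ℕ → Fin m → ℝ
  | 0 => 0
  | i + 1 => moveTowards (a i).1 (Ψ ((a i).2, iterateRetraction Ψ a i)) (iterateRetraction Ψ a i)

theorem continuous_iterateRetraction {K : Type*} {m : ℕ}
    {Ψ : (K → Fin m → ℝ) × (Fin m → ℝ) → Fin m → ℝ} (hΨ : Continuous Ψ) (i : ℕ) :
    Continuous fun a => iterateRetraction Ψ a i := by
  induction i with
  | zero => exact continuous_const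
  | succ i ih =>
    simp only [iterateRetraction]
    exact continuous_moveTowards (by fun_prop) (hΨ.comp (by fun_prop)) ih

/-- If step `s` maps everything to `P` and the later steps fix the points of `P`, then the steps
before `s` do not matter. -/
theorem iterateRetraction_mem {K : Type*} {m : ℕ} {Ψ : (K → Fin m → ℝ) × (Fin m → ℝ) → Fin m → ℝ}
    {a : ℕ → ℝ × (K → Fin m → ℝ)} {P : Set (Fin m → ℝ)} {s : ℕ}
    (hs : (a s).1 = 0) (hs' : ∀ x, Ψ ((a s).2, x) ∈ P) {N : ℕ}
    (hlater : ∀ i, s < i → i < N → ∀ x ∈ P, moveTowards (a i).1 (Ψ ((a i).2, x)) x = x)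
    (hsN : s < N) : iterateRetraction Ψ a N ∈ P := by
  obtain ⟨k, rfl⟩ := Nat.exists_eq_add_of_lt hsN
  induction k with
  | zero =>
    simp only [iterateRetraction, hs, moveTowards_zero]
    exact hs' _
  | succ k ih =>
    have h := ih (fun i hi hi' => hlater i hi (by omega)) (by omega)
    rw [← add_assoc, iterateRetraction, hlater _ (by omega) (by omega) _ h]
    exact h

/-- The elementary symmetric polynomial of degree `card J - k` in the `|h j|`. It is positive
exactly where at most `k` of the `h j` vanish. -/
def absEsymm {J : Type*} [Fintype J] (k : ℕ) (h : J → ℝ) : ℝ :=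
  ∑ S ∈ Finset.powersetCard (Fintype.card J - k) Finset.univ, ∏ j ∈ S, |h j|

theorem absEsymm_nonneg {J : Type*} [Fintype J] (k : ℕ) (h : J → ℝ) : 0 ≤ absEsymm k h :=
  Finset.sum_nonneg fun _ _ => Finset.prod_nonneg fun _ _ => abs_nonneg _

theorem continuous_absEsymm {J : Type*} [Fintype J] (k : ℕ) :
    Continuous (absEsymm k : (J → ℝ) → ℝ) := by
  unfold absEsymm
  fun_prop

theorem absEsymm_pos_iff {J E : Type*} [Fintype J] (k : ℕ) (h : E → J → ℝ) (θ : E) :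
    0 < absEsymm k (h θ) ↔ zeroCount h θ ≤ k := by
  classical
  have hcard : zeroCount h θ + (Finset.univ.filter fun j => h θ j ≠ 0).card = Fintype.card J := by
    rw [zeroCount, ← Finset.card_univ]
    convert Finset.card_filter_add_card_filter_not (s := Finset.univ) (fun j => h θ j = 0)
  constructor
  · intro hpos
    obtain ⟨S, hS, hS'⟩ := Finset.exists_ne_zero_of_sum_ne_zero hpos.ne'
    rw [Finset.mem_powersetCard] at hS
    have hsub : S ⊆ Finset.univ.filter fun j => h θ j ≠ 0 := by
      intro j hj
      have := Finset.prod_ne_zero_iff.1 hS' j hj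
      simpa using this
    have := Finset.card_le_card hsub
    omega
  · intro hle
    obtain ⟨S, hS, hScard⟩ := Finset.exists_subset_card_eq
      (show Fintype.card J - k ≤ (Finset.univ.filter fun j => h θ j ≠ 0).card by omega)
    refine Finset.sum_pos' (fun _ _ => Finset.prod_nonneg fun _ _ => abs_nonneg _)
      ⟨S, Finset.mem_powersetCard.2 ⟨Finset.subset_univ _, hScard⟩, Finset.prod_pos fun j hj => ?_⟩
    exact abs_pos.2 (Finset.mem_filter.1 (hS hj)).2

/-- Multiplication by the denominator removes the discontinuities of a bounded function. -/
theorem continuous_mul_of_continuousOn_pos {E : Type*} [TopologicalSpace E] {δ f : E → ℝ}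
    (hδ : Continuous δ) (hδ0 : ∀ θ, 0 ≤ δ θ) (hf : ContinuousOn f {θ | 0 < δ θ})
    (hf01 : ∀ θ, 0 ≤ f θ ∧ f θ ≤ 1) : Continuous fun θ => δ θ * f θ := by
  refine continuous_iff_continuousAt.2 fun θ₀ => ?_
  rcases (hδ0 θ₀).eq_or_lt with h0 | hpos
  · have hlim : Tendsto δ (𝓝 θ₀) (𝓝 0) := by
      have := hδ.tendsto θ₀
      rwa [← h0] at this
    rw [ContinuousAt, ← h0, zero_mul]
    exact squeeze_zero (fun θ => mul_nonneg (hδ0 θ) (hf01 θ).1)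
      (fun θ => mul_le_of_le_one_right (hδ0 θ) (hf01 θ).2) hlim
  · exact hδ.continuousAt.mul
      (hf.continuousAt ((isOpen_lt continuous_const hδ).mem_nhds hpos))

/-- Finitely many divisions in parallel, whose results are arbitrary where the denominator
vanishes, suffice to select a point of a polytope that depends continuously on a parameter. -/
theorem exists_parallel_division_selection {E : Type*} [TopologicalSpace E]
    [TopologicalSpace.MetrizableSpace E] {ρ : Type} [Fintype ρ] {m : ℕ}
    {B : E → ρ → Fin m → ℝ} {c : E → ρ → ℝ} (hB : Continuous B) (hc : Continuous c)
    (hcube : ∀ θ, ∀ x ∈ polyhedron (B θ) (c θ), ∀ j, 0 ≤ x j ∧ x j ≤ 1) :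
    ∃ (Q : Type) (_ : Fintype Q) (_ : Nonempty Q) (num den : Q → E → ℝ)
      (sel : (Q → ℝ) → Fin m → ℝ),
      (∀ q, Continuous (num q)) ∧ (∀ q, Continuous (den q)) ∧
      (∀ q θ, 0 ≤ num q θ ∧ num q θ ≤ den q θ) ∧ Continuous sel ∧
      ∀ θ, (polyhedron (B θ) (c θ)).Nonempty → ∀ a : Q → ℝ,
        (∀ q, 0 < den q θ → a q = num q θ / den q θ) → sel a ∈ polyhedron (B θ) (c θ) := by
  classical
  have hcpt : ∀ θ, IsCompact (polyhedron (B θ) (c θ)) := fun θ =>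
    (isCompact_Icc (a := (0 : Fin m → ℝ)) (b := 1)).of_isClosed_subset isClosed_polyhedron
      fun x hx => ⟨fun j => (hcube θ x hx j).1, fun j => (hcube θ x hx j).2⟩
  obtain ⟨Ψ, hΨ, hΨspec⟩ := exists_continuous_convexHull_retraction m (Finset ρ)
  let test : E → Finset ρ × Option ρ → ℝ := fun θ => feasibilityTest (B θ) (c θ)
  have htest : Continuous test := continuous_feasibilityTest hB hc
  let v₀ : E → Finset ρ → Fin m → ℝ := fun θ =>
    vertexFamily (fun j => SignType.sign (test θ j)) (B θ) (c θ)
  have hv₀hull : ∀ θ, (polyhedron (B θ) (c θ)).Nonempty →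
      convexHull ℝ (range (v₀ θ)) = polyhedron (B θ) (c θ) := fun θ =>
    vertexFamily_sign_spec (hcpt θ)
  have hv₀cube : ∀ θ k j, 0 ≤ v₀ θ k j ∧ v₀ θ k j ≤ 1 := by
    intro θ k j
    rcases (polyhedron (B θ) (c θ)).eq_empty_or_nonempty with h | h
    · have : v₀ θ = 0 := vertexFamily_eq_zero h
      simp [this]
    · refine hcube θ _ ?_ j
      rw [← hv₀hull θ h]
      exact subset_convexHull ℝ _ (mem_range_self k)
  let N := Fintype.card (Finset ρ × Option ρ)
  have hstage : ∀ i : ℕ, ∃ (v : E → Finset ρ → Fin m → ℝ) (η : E → ℝ),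
      ContinuousOn v {θ | zeroCount test θ ≤ i} ∧ ContinuousOn η {θ | zeroCount test θ ≤ i} ∧
      (∀ y k j, 0 ≤ v y k j ∧ v y k j ≤ 1) ∧ (∀ y, 0 ≤ η y ∧ η y ≤ 1) ∧
      (∀ y ∈ {θ | zeroCount test θ = i}, v y = v₀ y ∧ η y = 0) ∧
      ∀ y ∈ {θ | zeroCount test θ ≤ i}, ∀ x ∈ polyhedron (B y) (c y),
        moveTowards (η y) (Ψ (v y, x)) x = x := by
    intro i
    have hsub : {θ | zeroCount test θ = i} ⊆ {θ | zeroCount test θ ≤ i} := fun θ => Eq.le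
    refine exists_continuousOn_generators (Q := fun θ => polyhedron (B θ) (c θ)) hsub ?_
      (isClosed_setOf_mem_polyhedron hB hc) hcube hΨ (fun c x => (hΨspec c x).1)
      (fun c x => (hΨspec c x).2) (continuousOn_vertexFamily hB hc i)
      (fun θ _ => hv₀cube θ) ?_
    · refine ⟨{θ | i ≤ zeroCount test θ}, ?_, ?_⟩
      · rcases i with _ | i
        · simp
        · convert (isOpen_zeroCount_le htest i).isClosed_compl using 1
          ext θ
          exact Nat.lt_iff_add_one_le.symm.trans not_le.symm
      · ext θ
        exact le_antisymm_iff
    · intro θ _ x hx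
      rw [hv₀hull θ ⟨x, hx⟩]
      exact hx
  choose v η hv hη hv01 hη01 hX hid using hstage
  -- `N + 1` stages, since the number of vanishing polynomials ranges over `0, …, N`
  have hpos : ∀ i : ℕ, {θ | 0 < absEsymm i (test θ)} = {θ | zeroCount test θ ≤ i} := fun i => by
    ext θ; exact absEsymm_pos_iff i test θ
  let target : Fin (N + 1) × Option (Finset ρ × Fin m) → E → ℝ := fun q θ =>
    match q.2 with
    | none => η q.1 θ
    | some p => v q.1 θ p.1 p.2
  have htarget01 : ∀ q θ, 0 ≤ target q θ ∧ target q θ ≤ 1 := by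
    rintro ⟨i, _ | p⟩ θ
    · exact hη01 i θ
    · exact hv01 i θ p.1 p.2
  let unpack : (Fin (N + 1) × Option (Finset ρ × Fin m) → ℝ) → ℕ → ℝ × (Finset ρ → Fin m → ℝ) :=
    fun a i => if h : i < N + 1 then
      (a (⟨i, h⟩, none), fun T j => a (⟨i, h⟩, some (T, j))) else 0
  have hunpack : Continuous unpack := by
    refine continuous_pi fun i => ?_
    by_cases h : i < N + 1
    · simp only [unpack, h, dif_pos]
      fun_prop
    · simp only [unpack, h, dif_neg, not_false_eq_true]
      fun_prop
  refine ⟨Fin (N + 1) × Option (Finset ρ × Fin m), inferInstance, inferInstance,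
    fun q θ => absEsymm q.1 (test θ) * target q θ, fun q θ => absEsymm q.1 (test θ),
    fun a => iterateRetraction Ψ (unpack a) (N + 1), fun q => ?_, fun q => ?_, fun q θ => ⟨?_, ?_⟩, ?_, ?_⟩
  · refine continuous_mul_of_continuousOn_pos ((continuous_absEsymm _).comp htest)
      (fun θ => absEsymm_nonneg _ _) ?_ (htarget01 q)
    rw [hpos]
    rcases q with ⟨i, _ | p⟩
    · exact hη i
    · exact continuousOn_pi.1 (continuousOn_pi.1 (hv i) p.1) p.2
  · exact (continuous_absEsymm _).comp htest
  · exact mul_nonneg (absEsymm_nonneg _ _) (htarget01 q θ).1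
  · exact mul_le_of_le_one_right (absEsymm_nonneg _ _) (htarget01 q θ).2
  · exact (continuous_iterateRetraction hΨ (N + 1)).comp hunpack
  · intro θ hne a ha
    have hval : ∀ q : Fin (N + 1) × Option (Finset ρ × Fin m),
        zeroCount test θ ≤ q.1 → a q = target q θ := by
      intro q hq
      have h := (absEsymm_pos_iff q.1 test θ).2 hq
      rw [ha q h, mul_div_cancel_left₀ _ h.ne']
    have hunpack_eq : ∀ i, i < N + 1 → zeroCount test θ ≤ i → unpack a i = (η i θ, v i θ) := by
      intro i hi hle
      simp only [unpack, hi, dif_pos]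
      refine Prod.ext (hval (⟨i, hi⟩, none) hle) ?_
      funext T j
      exact hval (⟨i, hi⟩, some (T, j)) hle
    have hs : zeroCount test θ < N + 1 := Nat.lt_succ_of_le (zeroCount_le_card test θ)
    obtain ⟨hvs, hηs⟩ := hX _ θ rfl
    refine iterateRetraction_mem (s := zeroCount test θ) ?_ ?_ ?_ hs
    · rw [hunpack_eq _ hs le_rfl, hηs]
    · intro x
      rw [hunpack_eq _ hs le_rfl, hvs, ← hv₀hull θ hne]
      exact (hΨspec _ _).1
    · intro i hi hiN x hx
      rw [hunpack_eq i hiN hi.le]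
      exact hid i θ hi.le x hx

/-! ### Names of real numbers and continuous realizers -/

/-- The real number with the name `w`, as the sum of the differences of consecutive approximations.
Truncating the `i`-th difference to `[-2 * 2⁻ⁱ, 2 * 2⁻ⁱ]` does not affect names, and makes the function
total and continuous on all sequences. -/
noncomputable def realOfName (ν : ℕ ≃ ℚ) (w : Baire) : ℝ :=
  (ν (w 0) : ℝ) + ∑' i : ℕ,
    max (-(2 * (2 : ℝ)⁻¹ ^ i)) (min (2 * (2 : ℝ)⁻¹ ^ i) ((ν (w (i + 1)) : ℝ) - ν (w i)))

theorem norm_truncate_le {r : ℝ} (hr : 0 ≤ r) (x : ℝ) : ‖max (-r) (min r x)‖ ≤ r := by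
  rw [Real.norm_eq_abs, abs_le]
  exact ⟨le_max_left _ _, max_le (by linarith) (min_le_left _ _)⟩

theorem summable_two_mul_inv_two_pow : Summable fun i : ℕ => 2 * (2 : ℝ)⁻¹ ^ i :=
  (summable_geometric_of_lt_one (by norm_num) (by norm_num)).mul_left 2

theorem continuous_realOfName (ν : ℕ ≃ ℚ) : Continuous (realOfName ν) := by
  have hν : ∀ k : ℕ, Continuous fun w : Baire => (ν (w k) : ℝ) := fun k =>
    (continuous_of_discreteTopology (f := fun a : ℕ => (ν a : ℝ))).comp (continuous_apply k)
  refine (hν 0).add (continuous_tsum (fun i => ?_) summable_two_mul_inv_two_pow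
    fun i w => norm_truncate_le (by positivity) _)
  exact continuous_const.max (continuous_const.min ((hν (i + 1)).sub (hν i)))

theorem IsName.realOfName_eq {ν : ℕ ≃ ℚ} {w : Baire} {x : ℝ} (h : IsName ν w x) :
    realOfName ν w = x := by
  have hterm : ∀ i : ℕ, max (-(2 * (2 : ℝ)⁻¹ ^ i))
      (min (2 * (2 : ℝ)⁻¹ ^ i) ((ν (w (i + 1)) : ℝ) - ν (w i))) =
      (ν (w (i + 1)) : ℝ) - ν (w i) := by
    intro i
    have h1 := abs_le.1 (h i)
    have h2 := abs_le.1 (h (i + 1))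
    have h3 : (0 : ℝ) ≤ (2 : ℝ)⁻¹ ^ i := by positivity
    rw [pow_succ] at h2
    rw [min_eq_right (by linarith), max_eq_right (by linarith)]
  have hsum : Summable fun i : ℕ => (ν (w (i + 1)) : ℝ) - ν (w i) := by
    refine Summable.of_norm_bounded summable_two_mul_inv_two_pow fun i => ?_
    rw [← hterm i]
    exact norm_truncate_le (by positivity) _
  have hlim : Tendsto (fun i => (ν (w i) : ℝ)) atTop (𝓝 x) := by
    rw [tendsto_iff_norm_sub_tendsto_zero]
    exact squeeze_zero (fun i => norm_nonneg _) h
      (tendsto_pow_atTop_nhds_zero_of_lt_one (by norm_num) (by norm_num))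
  have htel := hsum.hasSum.tendsto_sum_nat
  simp only [Finset.sum_range_sub (fun i => (ν (w i) : ℝ))] at htel
  have := tendsto_nhds_unique htel (hlim.sub_const _)
  rw [realOfName]
  simp only [hterm]
  rw [this]
  ring

/-- A continuous real function on `κ → ℕ` has a locally constant approximation by rational numbers:
use the first cylinder, in some enumeration, that contains `w` and on which one rational number is
close enough to all values. -/
theorem exists_continuous_rat_approx (ν : ℕ ≃ ℚ) {κ : Type*} [Countable κ] {φ : (κ → ℕ) → ℝ}
    (hφ : Continuous φ) {ε : ℝ} (hε : 0 < ε) :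
    ∃ f : (κ → ℕ) → ℕ, Continuous f ∧ ∀ w, |((ν (f w) : ℚ) : ℝ) - φ w| ≤ ε := by
  classical
  obtain ⟨e, he⟩ := exists_surjective_nat (Finset (κ × ℕ))
  let C : ℕ → Set (κ → ℕ) := fun k => {w | ∀ p ∈ e k, w p.1 = p.2}
  have hC : ∀ k, IsClopen (C k) := by
    intro k
    have : C k = ⋂ p ∈ e k, (fun w : κ → ℕ => w p.1) ⁻¹' {p.2} := by ext; simp [C]
    rw [this]
    exact isClopen_biInter_finset fun p _ => (isClopen_discrete _).preimage (continuous_apply _)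
  let good : ℕ → Prop := fun k => ∃ q : ℕ, ∀ w ∈ C k, |((ν q : ℚ) : ℝ) - φ w| ≤ ε
  have hex : ∀ w, ∃ k, good k ∧ w ∈ C k := by
    intro w
    obtain ⟨r, hr⟩ := Rat.denseRange_cast.exists_mem_open
      (Metric.isOpen_ball (x := φ w) (ε := ε)) ⟨φ w, Metric.mem_ball_self hε⟩
    have hU : IsOpen {w' | |(r : ℝ) - φ w'| < ε} := isOpen_lt (by fun_prop) continuous_const
    obtain ⟨s, u, hu, hsub⟩ := isOpen_pi_iff.1 hU w (by simpa [Real.dist_eq] using hr)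
    obtain ⟨k, hk⟩ := he (s.image fun i => (i, w i))
    refine ⟨k, ⟨ν.symm r, fun w' hw' => ?_⟩, ?_⟩
    · rw [Equiv.apply_symm_apply]
      refine le_of_lt (hsub fun i hi => ?_)
      have : w' i = w i := hw' (i, w i) (by rw [hk]; exact Finset.mem_image_of_mem _ hi)
      rw [this]
      exact (hu i hi).2
    · intro p hp
      rw [hk] at hp
      obtain ⟨i, -, rfl⟩ := Finset.mem_image.1 hp
      rfl
  have hfind : Continuous fun w => Nat.find (hex w) := by
    refine continuous_discrete_rng.2 fun k => ?_
    have : (fun w => Nat.find (hex w)) ⁻¹' {k} =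
        {w | good k ∧ w ∈ C k} ∩ ⋂ j ∈ Finset.range k, {w | ¬ (good j ∧ w ∈ C j)} := by
      ext w
      simp [Nat.find_eq_iff]
    rw [this]
    have hgood : ∀ j, IsClopen {w | good j ∧ w ∈ C j} := by
      intro j
      by_cases hj : good j
      · simpa [hj] using hC j
      · simpa [hj] using isClopen_empty
    exact (hgood k).isOpen.inter
      (isOpen_biInter_finset fun j _ => (hgood j).compl.isOpen)
  refine ⟨fun w => (Nat.find_spec (hex w)).1.choose, ?_, fun w =>
    (Nat.find_spec (hex w)).1.choose_spec w (Nat.find_spec (hex w)).2⟩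
  have hcongr : (fun w => (Nat.find_spec (hex w)).1.choose) =
      (fun k => if h : good k then h.choose else 0) ∘ fun w => Nat.find (hex w) := by
    funext w
    simp [(Nat.find_spec (hex w)).1]
  rw [hcongr]
  exact continuous_of_discreteTopology.comp hfind

/-- Every continuous real function of finitely or countably many sequences has a continuous
realizer: a name of its value depends continuously on the arguments. -/
theorem exists_continuous_isName (ν : ℕ ≃ ℚ) {ι : Type*} [Countable ι] {φ : (ι → Baire) → ℝ}
    (hφ : Continuous φ) :
    ∃ Φ : (ι → Baire) → Baire, Continuous Φ ∧ ∀ u, IsName ν (Φ u) (φ u) := by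
  have hφ' : Continuous fun w : ι × ℕ → ℕ => φ fun i k => w (i, k) := hφ.comp (by fun_prop)
  choose f hf hfφ using fun k : ℕ =>
    exists_continuous_rat_approx ν hφ' (show (0 : ℝ) < 2⁻¹ ^ k by positivity)
  refine ⟨fun u k => f k fun p => u p.1 p.2, ?_, fun u k => hfφ k fun p => u p.1 p.2⟩
  exact continuous_pi fun k => (hf k).comp (by fun_prop)

/-! ### The reduction for systems of fixed size -/

/-- The matrix `A` with the rows of `v ≤ 1` and `-v ≤ 0` appended. -/
def boxedMatrix {n m : ℕ} (A : Fin n → Fin m → ℝ) : Fin n ⊕ (Fin m ⊕ Fin m) → Fin m → ℝ :=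
  Sum.elim A (Sum.elim (fun j => Pi.single j 1) fun j => -Pi.single j 1)

/-- The right-hand side `b` with those of `v ≤ 1` and `-v ≤ 0` appended. -/
def boxedVector {n m : ℕ} (b : Fin n → ℝ) : Fin n ⊕ (Fin m ⊕ Fin m) → ℝ :=
  Sum.elim b (Sum.elim 1 0)

theorem mem_polyhedron_boxed_iff {n m : ℕ} {A : Fin n → Fin m → ℝ} {b : Fin n → ℝ}
    {v : Fin m → ℝ} : v ∈ polyhedron (boxedMatrix A) (boxedVector b) ↔
      IsBoundedSolution (Matrix.of A) b v := by
  simp only [polyhedron, mem_ofPred_eq, IsBoundedSolution, Sum.forall, boxedMatrix, boxedVector,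
    Sum.elim_inl, Sum.elim_inr, single_dotProduct, neg_dotProduct, one_mul, Pi.one_apply,
    Pi.zero_apply, neg_nonpos, Matrix.mulVec, Matrix.of_apply]
  exact and_congr_right fun _ => and_comm.trans forall_and.symm

/-- For systems of fixed size: `G` asks `z` divisions, and `F` turns the answers into a solution.
Nothing but the answers enters `F`. -/
theorem exists_realizers (ν : ℕ ≃ ℚ) (n m : ℕ) :
    ∃ (z : ℕ+) (G : (Fin n → Fin m → Baire) × (Fin n → Baire) → Fin z → Baire × Baire)
      (F : (Fin z → Baire) → Fin m → Baire), Continuous G ∧ Continuous F ∧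
      (∀ p i, ∃ x y : ℝ, IsName ν (G p i).1 x ∧ IsName ν (G p i).2 y ∧ 0 ≤ x ∧ x ≤ y) ∧
      ∀ p A b, IsSystemName ν p A b → (∃ v, IsBoundedSolution A b v) →
        ∀ a : Fin z → Baire, (∀ i, ∀ x y : ℝ, IsName ν (G p i).1 x → IsName ν (G p i).2 y →
          0 < y → IsName ν (a i) (x / y)) →
        ∃ v, IsBoundedSolution A b v ∧ ∀ j, IsName ν (F a j) (v j) := by
  have hB : Continuous fun θ : (Fin n → Fin m → ℝ) × (Fin n → ℝ) => boxedMatrix θ.1 := by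
    refine continuous_pi fun i => ?_
    rcases i with i | i | i <;> simp only [boxedMatrix, Sum.elim_inl, Sum.elim_inr] <;> fun_prop
  have hc : Continuous fun θ : (Fin n → Fin m → ℝ) × (Fin n → ℝ) =>
      boxedVector (m := m) θ.2 := by
    refine continuous_pi fun i => ?_
    rcases i with i | i | i <;> simp only [boxedVector, Sum.elim_inl, Sum.elim_inr] <;> fun_prop
  obtain ⟨Q, _, _, num, den, sel, hnum, hden, hle, hsel, hspec⟩ :=
    exists_parallel_division_selection hB hc fun θ x hx => (mem_polyhedron_boxed_iff.1 hx).2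
  have hval := continuous_realOfName ν
  let decode : ((Fin n × Fin m) ⊕ Fin n → Baire) → (Fin n → Fin m → ℝ) × (Fin n → ℝ) := fun u =>
    (fun i j => realOfName ν (u (Sum.inl (i, j))), fun i => realOfName ν (u (Sum.inr i)))
  have hdecode : Continuous decode := by fun_prop
  let encode : (Fin n → Fin m → Baire) × (Fin n → Baire) → (Fin n × Fin m) ⊕ Fin n → Baire :=
    fun p => Sum.elim (fun ij => p.1 ij.1 ij.2) p.2
  have hencode : Continuous encode := by
    refine continuous_pi fun i => ?_
    rcases i with i | i <;> simp only [encode, Sum.elim_inl, Sum.elim_inr] <;> fun_prop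
  choose N hN hNname using fun q => exists_continuous_isName ν ((hnum q).comp hdecode)
  choose D hD hDname using fun q => exists_continuous_isName ν ((hden q).comp hdecode)
  let e : Q ≃ Fin (Fintype.card Q) := Fintype.equivFin Q
  have hsel' : Continuous fun a : Fin (Fintype.card Q) → Baire =>
      sel fun q => realOfName ν (a (e q)) := hsel.comp (by fun_prop)
  choose S hS hSname using fun j => exists_continuous_isName ν (continuous_pi_iff.1 hsel' j)
  refine ⟨⟨Fintype.card Q, Fintype.card_pos⟩,
    fun p i => (N (e.symm i) (encode p), D (e.symm i) (encode p)), fun a j => S j a,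
    by fun_prop, by fun_prop, fun p i => ⟨_, _, hNname _ _, hDname _ _, hle _ _⟩, ?_⟩
  intro p A b hp hsol a ha
  have hdec : decode (encode p) = (A, b) :=
    Prod.ext (funext fun i => funext fun j => (hp.1 i j).realOfName_eq)
      (funext fun i => (hp.2 i).realOfName_eq)
  obtain ⟨v, hv⟩ := hsol
  have hmem := hspec (A, b) ⟨v, mem_polyhedron_boxed_iff.2 hv⟩
    (fun q => realOfName ν (a (e q))) fun q hq => by
      have h := ha (e q) _ _ (hNname _ _) (hDname _ _)
      simp only [Function.comp_apply, hdec, Equiv.symm_apply_apply] at h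
      exact (h hq).realOfName_eq
  exact ⟨_, mem_polyhedron_boxed_iff.1 hmem, fun j => hSname j a⟩

/-! ### Disjoint sums of instances -/

theorem continuous_sigma_prod_map {ι : Type*} {X Y : ι → Type*} {W : Type*}
    [∀ i, TopologicalSpace (X i)] [∀ i, TopologicalSpace (Y i)] [TopologicalSpace W]
    {f : ∀ i, X i → W → Y i} (hf : ∀ i, Continuous fun p : X i × W => f i p.1 p.2) :
    Continuous fun p : (Σ i, X i) × W => (⟨p.1.1, f p.1.1 p.1.2 p.2⟩ : Σ i, Y i) := by
  rw [← Homeomorph.sigmaProdDistrib.symm.comp_continuous_iff']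
  exact continuous_sigma fun i => continuous_sigmaMk.comp (hf i)

theorem Continuous.partialContinuous {X Y : Type} [TopologicalSpace X] [TopologicalSpace Y]
    {f : X → Y} (hf : Continuous f) (D : Set X) :
    PartialContinuous fun x => (⟨x ∈ D, fun _ => f x⟩ : Part Y) :=
  hf.comp continuous_subtype_val

/-- The sequence of components of a finite tuple of any length, continued by `0`. It allows the
answers to be read without a comparison of their number with the number of questions. -/
def padTuple (a : Σ z : ℕ+, Fin z → Baire) (i : ℕ) : Baire :=
  if h : i < a.1 then a.2 ⟨i, h⟩ else 0

theorem continuous_padTuple : Continuous padTuple := by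
  refine continuous_sigma fun z => continuous_pi fun i => ?_
  by_cases h : i < z
  · simp only [padTuple, h, dif_pos]
    exact continuous_apply (A := fun _ : Fin z => Baire) ⟨i, h⟩
  · simp only [padTuple, h, dif_neg, not_false_eq_true]
    fun_prop

theorem theorem30 (ν : ℕ ≃ ℚ) (hν : ν 0 = 0) :
    Type2Reducible (bLinIneq ν) (parallelRDiv ν) := by
  choose z G F hG hF hGdom hspec using exists_realizers ν
  let Dom : ∀ nm : ℕ × ℕ, Set ((Fin nm.1 → Fin nm.2 → Baire) × (Fin nm.1 → Baire)) := fun nm =>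
    {p | ∃ A b, IsSystemName ν p A b ∧ ∃ v, IsBoundedSolution A b v}
  have hGc : Continuous fun w : Σ nm : ℕ × ℕ, (Fin nm.1 → Fin nm.2 → Baire) × (Fin nm.1 → Baire) =>
      (⟨z w.1.1 w.1.2, G w.1.1 w.1.2 w.2⟩ : Σ z : ℕ+, Fin z → Baire × Baire) :=
    continuous_sigma fun nm =>
      (continuous_sigmaMk (σ := fun z : ℕ+ => Fin z → Baire × Baire)).comp (hG nm.1 nm.2)
  have hFc : Continuous fun q : (Σ nm : ℕ × ℕ,
      (Fin nm.1 → Fin nm.2 → Baire) × (Fin nm.1 → Baire)) × (Σ z : ℕ+, Fin z → Baire) =>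
      (⟨q.1.1, F q.1.1.1 q.1.1.2 fun i => padTuple q.2 i⟩ : Σ nm : ℕ × ℕ, Fin nm.2 → Baire) :=
    (continuous_sigma_prod_map (ι := ℕ × ℕ) (Y := fun nm => Fin nm.2 → Baire) (W := ℕ → Baire)
      (f := fun (nm : ℕ × ℕ) _ a => F nm.1 nm.2 fun i => a i)
      fun nm => (hF nm.1 nm.2).comp (by fun_prop)).comp
      (continuous_id.prodMap continuous_padTuple)
  -- `F` is total, while `G` has to be restricted to the names of solvable systems
  refine ⟨_, _, hFc.partialContinuous univ, hGc.partialContinuous {w | w.2 ∈ Dom w.1}, ?_⟩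
  rintro g ⟨f, hf, rfl⟩
  choose d hd hfd using hf
  have hdom : ∀ (nm : ℕ × ℕ) p i, (d (z nm.1 nm.2) i (G nm.1 nm.2 p i)).Dom := by
    intro nm p i
    have h : (d (z nm.1 nm.2) i).Dom = _ := (hd (z nm.1 nm.2) i).1
    have : G nm.1 nm.2 p i ∈ (d (z nm.1 nm.2) i).Dom := by
      rw [h]
      exact hGdom nm.1 nm.2 p i
    exact this
  refine ⟨fun nm p => ⟨p ∈ Dom nm, fun _ => F nm.1 nm.2 fun i =>
    (d (z nm.1 nm.2) i (G nm.1 nm.2 p i)).get (hdom nm p i)⟩, fun nm => ⟨rfl, ?_⟩, ?_⟩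
  · rintro p _ ⟨⟨A, b, hp, hsol⟩, rfl⟩
    exact ⟨A, b, hp, hspec nm.1 nm.2 p A b hp hsol _ fun i x y hx hy hpos =>
      (hd (z nm.1 nm.2) i).2 _ _ (Part.get_mem (hdom nm p i)) x y hx hy hpos⟩
  · funext w
    refine Part.ext' ?_ fun h₁ h₂ => ?_
    · simp only [composeOracle, coprodFun, hfd, prodFun, Part.bind_dom, Part.map_Dom]
      exact ⟨fun h => h.1, fun h => ⟨h, fun i => hdom w.1 w.2 i, trivial⟩⟩
    · simp only [composeOracle, coprodFun, hfd, prodFun]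
      simp [padTuple, Part.bind, Part.assert, Part.map]
      rfl
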